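/- Theorem (weak convergence of the CCA estimator for fixed $p$). Let $G$ be a finite simple graph with $p$ vertices, $\sigma$ an ordering of its vertices, and $G_\sigma$ the resulting ordered graph on $\{1,\dots,p\}$ with edge set $E_\sigma$. Let $\mathbb{P}_{G_\sigma}$ be the set of positive definite $p\times p$ matrices whose $(i,j)$ entry is $0$ whenever $i\neq j$ and $(i,j)\notin E_\sigma$. The filled graph $G_\sigma^D$, with edge set $E_\sigma^D$, is the smallest graph on $\{1,\dots,p\}$ that is chordal, has the natural order as a perfect elimination scheme (if $u>v>w$ and $(u,w),(v,w)$ are edges, then $(u,v)$ is an edge), and satisfies $L_{ij}=0$ for all $i>j$ with $(i,j)$ not an edge of it, for the lower triangular Cholesky factor $L$ of every matrix in $\mathbb{P}_{G_\sigma}$. Given a sample covariance matrix $S$, the CCA estimator $\widehat\Omega$ is computed as follows. For each $j$ let $N_j=\{k>j:(k,j)\in E_\sigma^D\}$, $S^{>j}=(S_{kl})_{k,l\in N_j}$, $S^{>}_{\cdot j}=(S_{kj})_{k\in N_j}$ and $r_j=S_{jj}-(S^{>}_{\cdot j})^T(S^{>j})^{-1}S^{>}_{\cdot j}$. Let $\widehat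 L^D$ be the lower triangular matrix with $\widehat L^D_{jj}=r_j^{-1/2}$, with $(\widehat L^D_{kj})_{k\in N_j}=-r_j^{-1/2}(S^{>j})^{-1}S^{>}_{\cdot j}$, and with all other entries $0$. Start from $\widehat L=\widehat L^D$; for $i=2,\dots,p$ and, for each $i$, for $j=1,\dots,i-1$ in this order, if $(i,j)\notin E_\sigma$ set $\widehat L_{ij}\leftarrow-\big(\sum_{k=1}^{j-1}\widehat L_{ik}\widehat L_{jk}\big)/\widehat L_{jj}$. Finally $\widehat\Omega=\widehat L\widehat L^T$. (If $S$ does not allow one of these operations, the conventions $x/0=0$, $A^{-1}=0$ for singular $A$, and $\sqrt{x}=0$ for $x<0$ are used.) Let $Y_1,Y_2,\dots$ be i.i.d. random vectors in $\mathbb{R}^p$ ($p$ fixed) with distribution $F$, whose covariance matrix is $\bar\Omega^{-1}$ for some $\bar\Omega\in\mathbb{P}_{G_\sigma}$, and assume that $$\int_{\mathbb{R}^p}\prod_{i=1}^p|x_i|^{a_i}\,dF(x)<\infty$$ for all non-negative integers $a_1,\dots,a_p$ with $\sum_{i=1}^p a_i=4$. Let $S=S_n$ be the sample covariance matrix of $Y_1,\dots,Y_n$: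 either $\frac1n\sum_{t\le n}(Y_t-\bar Y)(Y_t-\bar Y)^T$, or the same with $\frac1{n-1}$ in place of $\frac1n$, or, if $F$ has mean zero, $\frac1n\sum_{t\le n}Y_tY_t^T$. Let $\widehat\Omega=\widehat\Omega_n$ be the CCA estimator computed from $S_n$. Then $\widehat\Omega_n$ is $\sqrt n$-consistent for $\bar\Omega$, i.e. for every $\varepsilon>0$ there is $M$ such that $P\big(\max_{i,j}\sqrt n\,|(\widehat\Omega_n)_{ij}-\bar\Omega_{ij}|>M\big)\le\varepsilon$ for all $n$; and, as $n\to\infty$, $\sqrt n(\widehat\Omega_n-\bar\Omega)$ converges in distribution to a (possibly degenerate) centred Gaussian random $p\times p$ matrix. -/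

import Mathlib

open MeasureTheory ProbabilityTheory Filter Matrix

noncomputable section

namespace CCA

/-! ### Ordered graphs and matrix spaces -/

/-- The ordered graph `G_σ` on the vertex set `V_p = Fin p`, for an ordering `σ` of the vertices
of `G`: its edges are the pairs `(σ u, σ v)` with `(u, v)` an edge of `G`. -/
def orderedGraph {V : Type*} {p : ℕ} (G : SimpleGraph V) (σ : V ≃ Fin p) : SimpleGraph (Fin p) :=
  G.map σ.toEmbedding

/-- `ℙ_H`: positive definite matrices whose off-diagonal entries vanish outside the edges of the
ordered graph `H`. -/
def posDefSpace {p : ℕ} (H : SimpleGraph (Fin p)) : Set (Matrix (Fin p) (Fin p) ℝ) :=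
  {A | A.PosDef ∧ ∀ i j, i ≠ j → ¬ H.Adj i j → A i j = 0}

/-- `𝕃⁺`: lower triangular matrices with positive diagonal entries. -/
def lowerPos (p : ℕ) : Set (Matrix (Fin p) (Fin p) ℝ) :=
  {L | (∀ i j, i < j → L i j = 0) ∧ ∀ i, 0 < L i i}

/-- `𝕃_H`: the Cholesky factors of the matrices in `ℙ_H`. -/
def cholSpace {p : ℕ} (H : SimpleGraph (Fin p)) : Set (Matrix (Fin p) (Fin p) ℝ) :=
  {L | L ∈ lowerPos p ∧ L * Lᵀ ∈ posDefSpace H}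

/-! ### Filled graphs -/

/-- No induced cycle of length at least four. -/
def IsDecomposable {V : Type*} (D : SimpleGraph V) : Prop :=
  ∀ m : ℕ, 4 ≤ m → IsEmpty (SimpleGraph.cycleGraph m ↪g D)

/-- The natural order of `Fin p` is a perfect vertex elimination scheme for `D`. -/
def IsPerfectElimination {p : ℕ} (D : SimpleGraph (Fin p)) : Prop :=
  ∀ u v w : Fin p, w < v → v < u → D.Adj u w → D.Adj v w → D.Adj u v

/-- `D` is an ordered decomposable graph whose edges carry all the nonzero entries below the
diagonal of the Cholesky factors of the matrices in `ℙ_H`. -/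
structure IsFillCover {p : ℕ} (H D : SimpleGraph (Fin p)) : Prop where
  decomposable : IsDecomposable D
  perfect : IsPerfectElimination D
  chol_zero : ∀ L ∈ cholSpace H, ∀ i j, j < i → ¬ D.Adj i j → L i j = 0

/-- The filled graph of the ordered graph `H`: the smallest fill cover of `H`
(see `isLeast_filledGraph`). -/
def filledGraph {p : ℕ} (H : SimpleGraph (Fin p)) : SimpleGraph (Fin p) :=
  sInf {D | IsFillCover H D}

open Fin.CommRing in
/-- A graph with a perfect vertex elimination scheme has no induced cycle of length `≥ 4`. -/
theorem IsPerfectElimination.isDecomposable {p : ℕ} {D : SimpleGraph (Fin p)}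
    (h : IsPerfectElimination D) : IsDecomposable D := by
  intro m hm
  refine ⟨fun f => ?_⟩
  obtain ⟨n, rfl⟩ : ∃ n, m = n + 4 := ⟨m - 4, by omega⟩
  obtain ⟨i, -, hi⟩ := Finset.exists_min_image (Finset.univ : Finset (Fin (n + 4)))
    (fun i => f i) ⟨0, Finset.mem_univ _⟩
  have h1 : (SimpleGraph.cycleGraph (n + 4)).Adj (i + 1) i := by
    rw [SimpleGraph.cycleGraph_adj]; left; ring
  have h2 : (SimpleGraph.cycleGraph (n + 4)).Adj (i - 1) i := by
    rw [SimpleGraph.cycleGraph_adj]; right; ring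
  have e1 : (2 : Fin (n + 4)) ≠ 1 := by
    intro e; have := congrArg Fin.val e
    simp [Nat.mod_eq_of_lt] at this
  have e2 : (-2 : Fin (n + 4)) ≠ 1 := by
    intro e
    have e3 : (3 : Fin (n + 4)) = 0 := by
      calc (3 : Fin (n + 4)) = 1 - (-2) := by ring
        _ = 0 := by rw [e]; ring
    have := congrArg Fin.val e3
    simp [Nat.mod_eq_of_lt] at this
  have e0 : (2 : Fin (n + 4)) ≠ 0 := by
    intro e; have := congrArg Fin.val e
    simp [Nat.mod_eq_of_lt] at this
  have h3 : ¬ (SimpleGraph.cycleGraph (n + 4)).Adj (i + 1) (i - 1) := by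
    rw [SimpleGraph.cycleGraph_adj]
    rintro (e | e)
    · exact e1 (by rw [← e]; ring)
    · exact e2 (by rw [← e]; ring)
  have h4 : i + 1 ≠ i - 1 := by
    intro e
    apply e0
    calc (2 : Fin (n + 4)) = (i + 1) - (i - 1) := by ring
      _ = 0 := by rw [e]; ring
  have l1 : f i < f (i + 1) :=
    lt_of_le_of_ne (hi _ (Finset.mem_univ _)) fun e => h1.ne (f.injective e).symm
  have l2 : f i < f (i - 1) :=
    lt_of_le_of_ne (hi _ (Finset.mem_univ _)) fun e => h2.ne (f.injective e).symm
  have a1 : D.Adj (f (i + 1)) (f i) := f.map_adj_iff.2 h1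
  have a2 : D.Adj (f (i - 1)) (f i) := f.map_adj_iff.2 h2
  rcases lt_trichotomy (f (i + 1)) (f (i - 1)) with l | l | l
  · exact h3 (f.map_adj_iff.1 (h _ _ _ l1 l a2 a1).symm)
  · exact h4 (f.injective l)
  · exact h3 (f.map_adj_iff.1 (h _ _ _ l2 l a1 a2))

/-- The filled graph is a fill cover, and its edges are edges of every fill cover. -/
theorem isLeast_filledGraph {p : ℕ} (H : SimpleGraph (Fin p)) :
    IsLeast {D | IsFillCover H D} (filledGraph H) := by
  have hp : IsPerfectElimination (filledGraph H) := by
    intro u v w hwv hvu huw hvw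
    simp only [filledGraph, SimpleGraph.sInf_adj] at huw hvw ⊢
    exact ⟨fun D hD => hD.perfect u v w hwv hvu (huw.1 D hD) (hvw.1 D hD), hvu.ne'⟩
  refine ⟨⟨hp.isDecomposable, hp, ?_⟩, fun D hD => sInf_le hD⟩
  intro L hL i j hij hadj
  simp only [filledGraph, SimpleGraph.sInf_adj] at hadj
  by_contra hne
  exact hadj ⟨fun D hD => by_contra fun hD' => hne (hD.chol_zero L hL i j hij hD'), hij.ne'⟩

/-! ### The estimator -/

/-- The later neighbours of `j` in `D`. -/
abbrev LaterNbr {p : ℕ} (D : SimpleGraph (Fin p)) (j : Fin p) : Type :=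
  {k : Fin p // j < k ∧ D.Adj k j}

/-- `S^{>j}`: the block of `S` on the later neighbours of `j`. -/
def blockGt {p : ℕ} (D : SimpleGraph (Fin p)) (S : Matrix (Fin p) (Fin p) ℝ) (j : Fin p) :
    Matrix (LaterNbr D j) (LaterNbr D j) ℝ :=
  Matrix.of fun k l => S k.1 l.1

/-- `S^{>}_{·j}`: the part of the `j`-th column of `S` on the later neighbours of `j`. -/
def colGt {p : ℕ} (D : SimpleGraph (Fin p)) (S : Matrix (Fin p) (Fin p) ℝ) (j : Fin p) :
    LaterNbr D j → ℝ :=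
  fun k => S k.1 j

open Classical in
/-- `(S^{>j})⁻¹ S^{>}_{·j}`. -/
def regCoef {p : ℕ} (D : SimpleGraph (Fin p)) (S : Matrix (Fin p) (Fin p) ℝ) (j : Fin p) :
    LaterNbr D j → ℝ :=
  (blockGt D S j)⁻¹ *ᵥ colGt D S j

open Classical in
/-- `S_{jj} - (S^{>}_{·j})ᵀ (S^{>j})⁻¹ S^{>}_{·j}`. -/
def residVar {p : ℕ} (D : SimpleGraph (Fin p)) (S : Matrix (Fin p) (Fin p) ℝ) (j : Fin p) : ℝ :=
  S j j - colGt D S j ⬝ᵥ regCoef D S j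

open Classical in
/-- Step I: the intermediate Cholesky factor `L̂ᴰ` computed from `S` by its closed form. -/
def interChol {p : ℕ} (D : SimpleGraph (Fin p)) (S : Matrix (Fin p) (Fin p) ℝ) :
    Matrix (Fin p) (Fin p) ℝ :=
  Matrix.of fun i j =>
    if i = j then 1 / √(residVar D S j)
    else if h : j < i ∧ D.Adj i j then -(regCoef D S j ⟨i, h⟩) / √(residVar D S j)
    else 0

open Classical in
/-- The body of the double loop of Step II: if `(i, j)` is not an edge of `H`, assign
`L_{ij} ← -(∑_{k < j} L_{ik} L_{jk}) / L_{jj}`. -/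
def updateEntry {p : ℕ} (H : SimpleGraph (Fin p)) (i j : Fin p)
    (L : Matrix (Fin p) (Fin p) ℝ) : Matrix (Fin p) (Fin p) ℝ :=
  if H.Adj i j then L
  else Matrix.of fun a b =>
    if a = i ∧ b = j then -(∑ k ∈ Finset.univ.filter (fun k => k < j), L i k * L j k) / L j j
    else L a b

/-- Step II: the double loop, `i` running upwards over all rows and, for each `i`, `j` running
upwards over the indices smaller than `i` (the first row has none). -/
def stepTwo {p : ℕ} (H : SimpleGraph (Fin p)) (L : Matrix (Fin p) (Fin p) ℝ) :
    Matrix (Fin p) (Fin p) ℝ :=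
  (List.finRange p).foldl
    (fun L i => ((List.finRange p).filter (fun j => decide (j < i))).foldl
      (fun L j => updateEntry H i j L) L) L

/-- The CCA Cholesky factor `L̂` computed from `S`. -/
def ccaChol {p : ℕ} (H : SimpleGraph (Fin p)) (S : Matrix (Fin p) (Fin p) ℝ) :
    Matrix (Fin p) (Fin p) ℝ :=
  stepTwo H (interChol (filledGraph H) S)

/-- The CCA estimator `Ω̂ = L̂ L̂ᵀ` computed from `S`. -/
def ccaEstimator {p : ℕ} (H : SimpleGraph (Fin p)) (S : Matrix (Fin p) (Fin p) ℝ) :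
    Matrix (Fin p) (Fin p) ℝ :=
  ccaChol H S * (ccaChol H S)ᵀ

/-! ### Covariance matrices -/

/-- The covariance matrix of a distribution on `ℝᵖ`. -/
def covarianceMatrix {p : ℕ} (F : Measure (Fin p → ℝ)) : Matrix (Fin p) (Fin p) ℝ :=
  Matrix.of fun i j => cov[fun x => x i, fun x => x j; F]

/-- The sample mean of `y 0, …, y (n - 1)`. -/
def sampleMean {p : ℕ} (n : ℕ) (y : ℕ → Fin p → ℝ) : Fin p → ℝ :=
  fun i => (n : ℝ)⁻¹ * ∑ t ∈ Finset.range n, y t i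

/-- The usual normalizations of the sample covariance matrix. -/
inductive SampleCovKind
  /-- products about zero, divided by `n` (for distributions with mean zero) -/
  | aboutZero
  /-- products about the sample mean, divided by `n` -/
  | aboutMean
  /-- products about the sample mean, divided by `n - 1` -/
  | aboutMeanUnbiased

/-- The sample covariance matrix of `y 0, …, y (n - 1)`. -/
def sampleCov {p : ℕ} (c : SampleCovKind) (n : ℕ) (y : ℕ → Fin p → ℝ) :
    Matrix (Fin p) (Fin p) ℝ :=
  match c with
  | .aboutZero => Matrix.of fun i j => (n : ℝ)⁻¹ * ∑ t ∈ Finset.range n, y t i * y t j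
  | .aboutMean => Matrix.of fun i j =>
      (n : ℝ)⁻¹ * ∑ t ∈ Finset.range n,
        (y t i - sampleMean n y i) * (y t j - sampleMean n y j)
  | .aboutMeanUnbiased => Matrix.of fun i j =>
      ((n : ℝ) - 1)⁻¹ * ∑ t ∈ Finset.range n,
        (y t i - sampleMean n y i) * (y t j - sampleMean n y j)

end CCA

end

/-! The estimator is a fixed map of $S$, so the theorem is an instance of the delta method. The
multivariate central limit theorem, applied to centred monomials of degree one and two (square
integrable by the fourth moments), makes $\sqrt n(S_n-\bar\Omega^{-1})$ asymptotically centred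
Gaussian: `asympNormal_sampleCov`. It remains to see that the map sends $\bar\Omega^{-1}$ to
$\bar\Omega$ and is differentiable there: `ccaEstimator_eq_and_differentiableAt`.

Write $\bar\Omega=LL^T$ with $L$ its Cholesky factor. Since $\bar\Omega^{-1}L=L^{-T}$ is upper
triangular and $L$ vanishes off the filled graph, the columns of this identity are the regression
equations of Step I, which therefore returns $L$. As $LL^T$ vanishes off the edges, no update of
Step II changes $L$. All denominators met on the way are nonzero at $\bar\Omega^{-1}$, hence
differentiability. Finally, $\sqrt n$-consistency is tightness of a sequence converging in
distribution. -/

namespace CCA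

open scoped Topology

/-! ### Asymptotic normality, tightness and the delta method. -/

section AsympNormal

variable {Ω : Type*} [MeasurableSpace Ω] {P : Measure Ω} [IsProbabilityMeasure P]
  {F : Type*} [NormedAddCommGroup F] [MeasurableSpace F] [BorelSpace F]

/-- A limit in distribution given by a map on a probability space is the law of that map. -/
theorem _root_.MeasureTheory.TendstoInDistribution.id_map {X : ℕ → Ω → F}
    {E : Type*} [MeasurableSpace E] {ν : Measure E} [IsProbabilityMeasure ν]
    {f : E → F} [IsProbabilityMeasure (ν.map f)]
    (h : TendstoInDistribution X atTop f (fun _ => P) ν) :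
    TendstoInDistribution X atTop id (fun _ => P) (ν.map f) where
  forall_aemeasurable := h.forall_aemeasurable
  aemeasurable_limit := aemeasurable_id
  tendsto := by
    convert! h.tendsto using 2
    exact congrArg 𝓝 (Subtype.ext Measure.map_id)

variable {E : Type*} [NormedAddCommGroup E] [MeasurableSpace E] [BorelSpace E]

/-- A sequence converging in distribution is bounded in probability. -/
theorem _root_.MeasureTheory.TendstoInDistribution.exists_bound [SecondCountableTopology E]
    [CompleteSpace E] {X : ℕ → Ω → E} {ν : Measure E} [IsProbabilityMeasure ν]
    (h : TendstoInDistribution X atTop id (fun _ => P) ν) {ε : ℝ} (hε : 0 < ε) :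
    ∃ M : ℝ, ∀ n, P.real {ω | M < ‖X n ω‖} ≤ ε := by
  -- A convergent sequence together with its limit is compact, so the converse half of Prokhorov's
  -- theorem gives tightness, with one bound for all `n`.
  have hcomp := (isTightMeasureSet_of_isCompact_closure
    (h.tendsto.isCompact_insert_range.closure_of_subset (Set.subset_insert _ _)))
  have hr := (ENNReal.tendsto_nhds_zero.1 (tendsto_measure_norm_gt_of_isTightMeasureSet hcomp))
    (ENNReal.ofReal ε) (by simpa using hε)
  obtain ⟨M, hM⟩ := hr.exists
  refine ⟨M, fun n => ?_⟩
  have hn : P.map (X n) {x | M < ‖x‖} ≤ ENNReal.ofReal ε := by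
    refine le_trans ?_ hM
    exact le_iSup₂_of_le (P.map (X n)) ⟨_, ⟨n, rfl⟩, rfl⟩ le_rfl
  rw [Measure.map_apply_of_aemeasurable (h.forall_aemeasurable n)
    (measurableSet_lt measurable_const measurable_norm)] at hn
  exact ENNReal.toReal_le_of_le_ofReal hε.le hn

variable [NormedSpace ℝ E] [NormedSpace ℝ F]

/-- `√n (T n - θ)` converges in distribution to a centred Gaussian law. -/
def AsympNormal (P : Measure Ω) [IsProbabilityMeasure P] (T : ℕ → Ω → E) (θ : E) : Prop :=
  ∃ (ν : Measure E) (_ : IsGaussian ν), ∫ x, x ∂ν = 0 ∧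
    TendstoInDistribution (fun (n : ℕ) ω => √(n : ℝ) • (T n ω - θ)) atTop id (fun _ => P) ν

theorem AsympNormal.exists_bound [SecondCountableTopology E] [CompleteSpace E]
    {T : ℕ → Ω → E} {θ : E} (h : AsympNormal P T θ) {ε : ℝ} (hε : 0 < ε) :
    ∃ M : ℝ, ∀ n : ℕ, P.real {ω | M < √(n : ℝ) * ‖T n ω - θ‖} ≤ ε := by
  obtain ⟨ν, hν, -, hT⟩ := h
  obtain ⟨M, hM⟩ := hT.exists_bound hε
  refine ⟨M, fun n => ?_⟩
  simpa [norm_smul, abs_of_nonneg (Real.sqrt_nonneg _)] using hM n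

/-- The delta method. -/
theorem AsympNormal.comp_hasFDerivAt [SecondCountableTopology E] [CompleteSpace E]
    [SecondCountableTopology F] [CompleteSpace F]
    {T : ℕ → Ω → E} {θ : E} (h : AsympNormal P T θ) {f : E → F} {f' : E →L[ℝ] F}
    (hf : HasFDerivAt f f' θ) (hm : ∀ n, AEMeasurable (fun ω => f (T n ω)) P) :
    AsympNormal P (fun n ω => f (T n ω)) (f θ) := by
  have hbound := fun ε hε => h.exists_bound (ε := ε) hε
  obtain ⟨ν, hν, h0, hT⟩ := h
  refine ⟨ν.map f', inferInstance, ?_, ?_⟩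
  · rw [integral_map (by fun_prop) (by fun_prop),
      f'.integral_comp_comm (by exact IsGaussian.integrable_id), h0, map_zero]
  refine TendstoInDistribution.id_map ?_
  have hlin := hT.continuous_comp f'.continuous
  -- By Slutsky, only the remainder, scaled by $\sqrt n$, has to vanish in probability.
  refine tendstoInDistribution_of_tendstoInMeasure_sub _ _ hlin ?_
    (fun n => ((hm n).sub_const _).const_smul _)
  rw [tendstoInMeasure_iff_measureReal_norm]
  intro ε hε
  rw [tendsto_order]
  refine ⟨fun a ha => Eventually.of_forall fun n => ha.trans_le measureReal_nonneg, fun δ hδ => ?_⟩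
  obtain ⟨M, hM⟩ := hbound (δ / 2) (half_pos hδ)
  -- Off an event of probability at most `δ / 2`, $\sqrt n\|T_n-\theta\|\le M$. For large `n` this
  -- puts $T_n$ in the ball where the little-o bound holds, and the constant is chosen to make the
  -- scaled remainder at most `ε / 2`. The maximum with `1` only secures positivity.
  have hM' : 0 < max M 1 := lt_max_of_lt_right one_pos
  have hc : 0 < ε / (2 * max M 1) := by positivity
  obtain ⟨r, hr, hball⟩ := Metric.eventually_nhds_iff.1 (hf.isLittleO.def hc)
  have hev : ∀ᶠ n : ℕ in atTop, max M 1 / r < √(n : ℝ) :=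
    (Real.tendsto_sqrt_atTop.comp tendsto_natCast_atTop_atTop).eventually_gt_atTop _
  filter_upwards [hev] with n hn
  refine (measureReal_mono (s₂ := {ω | M < √(n : ℝ) * ‖T n ω - θ‖}) ?_).trans_lt
    ((hM n).trans_lt (half_lt_self hδ))
  intro ω hω
  simp only [Set.mem_ofPred_eq, Pi.sub_apply, Pi.zero_apply, sub_zero, Function.comp_apply] at hω ⊢
  by_contra! hle
  have hle' := hle.trans (le_max_left M 1)
  have hn0 : 0 < √(n : ℝ) := (div_pos hM' hr).trans hn
  have hlt : dist (T n ω) θ < r := by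
    rw [dist_eq_norm]
    rw [div_lt_iff₀ hr] at hn
    exact lt_of_mul_lt_mul_left (hle'.trans_lt hn) hn0.le
  have hR := hball hlt
  rw [map_smul, ← smul_sub, norm_smul, Real.norm_of_nonneg hn0.le] at hω
  have : √(n : ℝ) * ‖f (T n ω) - f θ - f' (T n ω - θ)‖ ≤ ε / 2 := by
    calc _ ≤ √(n : ℝ) * (ε / (2 * max M 1) * ‖T n ω - θ‖) := by gcongr
      _ = ε / (2 * max M 1) * (√(n : ℝ) * ‖T n ω - θ‖) := by ring
      _ ≤ ε / (2 * max M 1) * max M 1 := by gcongr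
      _ = ε / 2 := by field_simp
  linarith

/-- Slutsky applied to $\sqrt n(c_nT_n-\theta)=c_n\sqrt n(T_n-\theta)+\sqrt n(c_n-1)\theta$. -/
theorem AsympNormal.smul [SecondCountableTopology E] {T : ℕ → Ω → E} {θ : E}
    (h : AsympNormal P T θ) {c : ℕ → ℝ} (hc : Tendsto c atTop (𝓝 1))
    (hc' : Tendsto (fun n : ℕ => √(n : ℝ) * (c n - 1)) atTop (𝓝 0)) :
    AsympNormal P (fun n ω => c n • T n ω) θ := by
  obtain ⟨ν, hν, h0, hT⟩ := h
  refine ⟨ν, hν, h0, ?_⟩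
  have hconst : TendstoInMeasure P (fun (n : ℕ) (_ : Ω) => (c n, √(n : ℝ) * (c n - 1))) atTop
      (fun _ => ((1 : ℝ), (0 : ℝ))) :=
    tendstoInMeasure_of_tendsto_ae (fun n => aestronglyMeasurable_const)
      (ae_of_all _ fun _ => hc.prodMk_nhds hc')
  have := hT.continuous_comp_prodMk_of_tendstoInMeasure_const
    (g := fun q : E × ℝ × ℝ => q.2.1 • q.1 + q.2.2 • θ) (by fun_prop) hconst
    (fun n => aemeasurable_const)
  convert! this using 1
  · ext n ω
    simp only
    module
  · ext x
    simp

end AsympNormal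

/-! ### The multivariate central limit theorem. -/

section CentralLimit

variable {Ω : Type*} [MeasurableSpace Ω] {P : Measure Ω} [IsProbabilityMeasure P]
  {ι : Type*} [Fintype ι]

/-- The covariance matrix of a square integrable random vector. -/
noncomputable def covMatrix (P : Measure Ω) (X : Ω → ι → ℝ) : Matrix ι ι ℝ :=
  Matrix.of fun i j => cov[fun ω => X ω i, fun ω => X ω j; P]

theorem dotProduct_covMatrix_mulVec {X : Ω → ι → ℝ} (hX : ∀ i, MemLp (fun ω => X ω i) 2 P)
    (t : ι → ℝ) : t ⬝ᵥ covMatrix P X *ᵥ t = Var[fun ω => ∑ i, t i * X ω i; P] := by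
  rw [variance_fun_sum' fun i _ => (hX i).const_mul _]
  simp only [dotProduct, mulVec, covMatrix, Matrix.of_apply, Finset.mul_sum,
    covariance_const_mul_left, covariance_const_mul_right]
  exact Finset.sum_congr rfl fun i _ => Finset.sum_congr rfl fun j _ => by ring

theorem posSemidef_covMatrix {X : Ω → ι → ℝ} (hX : ∀ i, MemLp (fun ω => X ω i) 2 P) :
    (covMatrix P X).PosSemidef := by
  refine PosSemidef.of_dotProduct_mulVec_nonneg ?_ fun t => ?_
  · ext i j
    simp [covMatrix, covariance_comm]
  · rw [star_trivial, dotProduct_covMatrix_mulVec hX]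
    exact variance_nonneg _ _

/-- The multivariate central limit theorem. -/
theorem asympNormal_mean {X : ℕ → Ω → ι → ℝ} (hindep : iIndepFun X P)
    (hident : ∀ k, IdentDistrib (X k) (X 0) P P) (hX : ∀ i, MemLp (fun ω => X 0 ω i) 2 P) :
    AsympNormal P (fun n ω => (n : ℝ)⁻¹ • ∑ k ∈ Finset.range n, X k ω)
      (fun i => ∫ ω, X 0 ω i ∂P) := by
  classical
  have hmX : ∀ k, AEMeasurable (X k) P := fun k => (hident k).aemeasurable_fst
  set θ : ι → ℝ := fun i => ∫ ω, X 0 ω i ∂P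
  let ν := multivariateGaussian (0 : EuclideanSpace ℝ ι) (covMatrix P (X 0))
  let Z : ℕ → Ω → EuclideanSpace ℝ ι := fun n ω =>
    WithLp.toLp 2 (√(n : ℝ) • ((n : ℝ)⁻¹ • ∑ k ∈ Finset.range n, X k ω - θ))
  have hmZ : ∀ n, AEMeasurable (Z n) P := fun n => by
    have : AEMeasurable (fun ω => ∑ k ∈ Finset.range n, X k ω) P :=
      Finset.aemeasurable_fun_sum _ fun k _ => hmX k
    fun_prop
  have hZ : TendstoInDistribution Z atTop id (fun _ => P) ν := by
    refine ⟨hmZ, aemeasurable_id, ?_⟩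
    -- Cramér–Wold: the characteristic function at `t` is that of the projection `u` at `1`, so the
    -- one-dimensional theorem suffices.
    refine ProbabilityMeasure.tendsto_iff_tendsto_charFun.2 fun t => ?_
    let u : (ι → ℝ) → ℝ := fun x => ∑ i, t i * x i
    have hu : Measurable u := by fun_prop
    have huL : MemLp (fun ω => u (X 0 ω)) 2 P :=
      memLp_finsetSum _ fun i _ => (hX i).const_mul (t i)
    have huE : ∫ ω, u (X 0 ω) ∂P = u θ := by
      simp only [u]
      rw [integral_finsetSum _ fun i _ => ((hX i).const_mul _).integrable one_le_two]
      simp only [integral_const_mul, θ]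
    have hclt := tendstoInDistribution_inv_sqrt_mul_sum_sub (X := fun k ω => u (X k ω))
      (Y := id) (P' := gaussianReal 0 (Var[fun ω => u (X 0 ω); P]).toNNReal)
      HasLaw.id huL (hindep.comp (fun _ => u) fun _ => hu) (fun k => (hident k).comp hu)
    have hchar := ProbabilityMeasure.tendsto_iff_tendsto_charFun.1 hclt.tendsto 1
    simp only [ProbabilityMeasure.coe_mk, Measure.map_id] at hchar ⊢
    rw [charFun_gaussianReal] at hchar
    rw [charFun_multivariateGaussian (posSemidef_covMatrix hX), dotProduct_covMatrix_mulVec hX]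
    convert! hchar using 2 with n
    · rw [charFun_apply, charFun_apply, integral_map (hmZ n) (by fun_prop),
        integral_map (hclt.forall_aemeasurable n) (by fun_prop)]
      congr 1 with ω
      congr 3
      rw [huE]
      rcases Nat.eq_zero_or_pos n with rfl | hn
      · simp [Z]
      have hn' : (0 : ℝ) < n := by exact_mod_cast hn
      have hs : √(n : ℝ) * (n : ℝ)⁻¹ = (√(n : ℝ))⁻¹ := by
        rw [← div_eq_mul_inv, Real.sqrt_div_self']; simp
      have hs' : √(n : ℝ) = (√(n : ℝ))⁻¹ * n := by
        rw [← div_eq_inv_mul, Real.div_sqrt]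
      simp only [Z, EuclideanSpace.inner_eq_star_dotProduct, star_trivial, dotProduct, u,
        Pi.smul_apply, Pi.sub_apply, Finset.sum_apply, smul_eq_mul, RCLike.inner_apply,
        conj_trivial, one_mul]
      rw [Finset.sum_comm]
      simp_rw [← Finset.mul_sum]
      rw [Finset.mul_sum _ _ (n : ℝ), ← Finset.sum_sub_distrib, Finset.mul_sum]
      refine Finset.sum_congr rfl fun i _ => ?_
      linear_combination (t i * ∑ k ∈ Finset.range n, X k ω i) * hs - t i * θ i * hs'
    · simp only [Real.coe_toNNReal _ (variance_nonneg _ _), u]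
      simp
  refine ⟨ν.map (WithLp.ofLp), ?_, ?_, ?_⟩
  · exact inferInstanceAs (IsGaussian (ν.map (EuclideanSpace.equiv ι ℝ)))
  · have := (EuclideanSpace.equiv ι ℝ).toContinuousLinearMap.integral_comp_comm
      (μ := ν) (φ := fun x => x) (by exact IsGaussian.integrable_id)
    rw [integral_map (by fun_prop) (by fun_prop)]
    refine this.trans ?_
    simp [ν]
  · have : IsProbabilityMeasure (ν.map (WithLp.ofLp : EuclideanSpace ℝ ι → ι → ℝ)) :=
      Measure.isProbabilityMeasure_map (by fun_prop)
    exact TendstoInDistribution.id_map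
      (hZ.continuous_comp (g := (WithLp.ofLp : EuclideanSpace ℝ ι → ι → ℝ)) (by fun_prop))

end CentralLimit

/-! ### Triangular matrices and the Cholesky factor. -/

section Triangular

variable {p : ℕ}

theorem inv_apply_eq_zero_of_lower {L : Matrix (Fin p) (Fin p) ℝ} (hL : ∀ i j, i < j → L i j = 0)
    (hdet : IsUnit L.det) {i j : Fin p} (hij : i < j) : L⁻¹ i j = 0 := by
  have := L.invertibleOfIsUnitDet hdet
  have hT : BlockTriangular L OrderDual.toDual := fun a b hab => hL a b hab
  exact blockTriangular_inv_of_blockTriangular hT hij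

theorem inv_apply_self_mul_of_lower {L : Matrix (Fin p) (Fin p) ℝ} (hL : ∀ i j, i < j → L i j = 0)
    (hdet : IsUnit L.det) (j : Fin p) : L⁻¹ j j * L j j = 1 := by
  have h := congrFun (congrFun (nonsing_inv_mul L hdet) j) j
  rw [one_apply_eq, mul_apply, Finset.sum_eq_single j] at h
  · exact h
  · intro k _ hk
    rcases hk.lt_or_gt with hk | hk
    · rw [hL k j hk, mul_zero]
    · rw [inv_apply_eq_zero_of_lower hL hdet hk, zero_mul]
  · simp

theorem isUnit_det_of_mem_lowerPos {L : Matrix (Fin p) (Fin p) ℝ} (hL : L ∈ lowerPos p) :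
    IsUnit L.det := by
  rw [isUnit_iff_ne_zero, det_of_isLowerTriangular L fun i j hij => hL.1 i j hij]
  exact Finset.prod_ne_zero_iff.2 fun i _ => (hL.2 i).ne'

/-- The Cholesky decomposition of a positive definite matrix. -/
theorem exists_cholesky {A : Matrix (Fin p) (Fin p) ℝ} (hA : A.PosDef) :
    ∃ L ∈ lowerPos p, L * Lᵀ = A := by
  set M := LDL.lowerInv hA
  set D := LDL.diagEntries hA
  have hMdet : IsUnit M.det := isUnit_det_of_invertible M
  have hD : ∀ i, 0 < D i := by
    have h : (LDL.diag hA).PosDef := by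
      rw [LDL.diag_eq_lowerInv_conj]
      exact hA.mul_mul_conjTranspose_same (vecMul_injective_of_isUnit
        ((isUnit_iff_isUnit_det _).2 hMdet))
    exact posDef_diagonal_iff.1 h
  have hMlow : ∀ i j, i < j → M i j = 0 := fun i j hij => LDL.lowerInv_triangular hA hij
  have hlow : ∀ i j, i < j → M⁻¹ i j = 0 := fun i j hij =>
    inv_apply_eq_zero_of_lower hMlow hMdet hij
  have hne : ∀ j, M⁻¹ j j ≠ 0 := fun j h => by
    simpa [h] using inv_apply_self_mul_of_lower hMlow hMdet j
  -- The sign of the diagonal entry is built into the square root of `D`, which makes the diagonal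
  -- of `M⁻¹ * diagonal d` positive.
  let d : Fin p → ℝ := fun j => √(D j) * (M⁻¹ j j / |M⁻¹ j j|)
  have hd : ∀ j, d j * d j = D j := fun j => by
    have h1 : √(D j) * √(D j) = D j := Real.mul_self_sqrt (hD j).le
    have h2 : |M⁻¹ j j| * |M⁻¹ j j| = M⁻¹ j j * M⁻¹ j j := abs_mul_abs_self _
    have h3 : |M⁻¹ j j| ≠ 0 := abs_ne_zero.2 (hne j)
    simp only [d]
    field_simp
    rw [pow_two, pow_two, pow_two, h1, h2, mul_comm]
  refine ⟨M⁻¹ * diagonal d, ⟨fun i j hij => ?_, fun j => ?_⟩, ?_⟩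
  · rw [mul_diagonal, hlow i j hij, zero_mul]
  · rw [mul_diagonal]
    have h2 : M⁻¹ j j * d j = √(D j) * (M⁻¹ j j * M⁻¹ j j) / |M⁻¹ j j| := by simp only [d]; ring
    rw [h2, ← abs_mul_abs_self]
    have := abs_pos.2 (hne j)
    have := Real.sqrt_pos.2 (hD j)
    positivity
  · rw [transpose_mul, diagonal_transpose, Matrix.mul_assoc, ← Matrix.mul_assoc (diagonal d),
      diagonal_mul_diagonal, ← Matrix.mul_assoc]
    simp_rw [hd]
    exact LDL.lower_conj_diag hA

/-- The right side is upper triangular with diagonal $1/L_{jj}$; both facts are read off column by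
column to evaluate Step I. -/
theorem inv_mul_transpose_mul {L : Matrix (Fin p) (Fin p) ℝ} (hdet : IsUnit L.det) :
    (L * Lᵀ)⁻¹ * L = (L⁻¹)ᵀ := by
  rw [Matrix.mul_inv_rev, Matrix.mul_assoc, nonsing_inv_mul _ hdet, Matrix.mul_one,
    transpose_nonsing_inv]

end Triangular

/-! ### Both steps of the algorithm fix the true Cholesky factor. -/

section FixedPoint

variable {p : ℕ} {H D : SimpleGraph (Fin p)} {L : Matrix (Fin p) (Fin p) ℝ}

open Classical in
theorem mul_apply_eq_add_sum_laterNbr (hL : L ∈ lowerPos p)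
    (hD : ∀ i j, j < i → ¬ D.Adj i j → L i j = 0) (S : Matrix (Fin p) (Fin p) ℝ) (i j : Fin p) :
    (S * L) i j = S i j * L j j + ∑ k : LaterNbr D j, S i k.1 * L k.1 j := by
  rw [mul_apply, ← Finset.add_sum_erase _ _ (Finset.mem_univ j)]
  congr 1
  rw [← Finset.sum_subtype (Finset.univ.filter fun k => j < k ∧ D.Adj k j) (by simp)
    fun k => S i k * L k j]
  symm
  refine Finset.sum_subset (fun k hk => ?_) fun k hk hk' => ?_
  · simp only [Finset.mem_filter, Finset.mem_univ, true_and] at hk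
    simpa using hk.1.ne'
  · simp only [Finset.mem_filter, Finset.mem_univ, true_and, not_and] at hk'
    have hkj : k ≠ j := by simpa using hk
    rcases hkj.lt_or_gt with h | h
    · rw [hL.1 k j h, mul_zero]
    · rw [hD k j h (hk' h), mul_zero]

theorem posDef_inv_of_mem_lowerPos (hL : L ∈ lowerPos p) : ((L * Lᵀ)⁻¹).PosDef := by
  refine PosDef.inv ?_
  have := PosDef.one.mul_mul_conjTranspose_same (n := Fin p) (R := ℝ) (vecMul_injective_of_isUnit
        ((isUnit_iff_isUnit_det _).2 (isUnit_det_of_mem_lowerPos hL)))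
  simpa using this

open Classical in
theorem blockGt_det_ne_zero {S : Matrix (Fin p) (Fin p) ℝ} (hS : S.PosDef) (j : Fin p) :
    (blockGt D S j).det ≠ 0 :=
  (hS.submatrix (e := (Subtype.val : LaterNbr D j → Fin p)) Subtype.val_injective).det_pos.ne'

/-- For $i\in N_j$ the entry $(i,j)$ of $SL=L^{-T}$ is zero. These equations read $S^{>}_{\cdot
j}L_{jj}+S^{>j}L_{N_jj}=0$, and the block is invertible. -/
theorem regCoef_eq (hL : L ∈ lowerPos p) (hD : ∀ i j, j < i → ¬ D.Adj i j → L i j = 0)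
    (j : Fin p) (k : LaterNbr D j) : regCoef D (L * Lᵀ)⁻¹ j k = -(L j j)⁻¹ * L k.1 j := by
  classical
  set S := (L * Lᵀ)⁻¹ with hS
  have hdet := isUnit_det_of_mem_lowerPos hL
  have hpos : S.PosDef := posDef_inv_of_mem_lowerPos hL
  have hcol : colGt D S j = blockGt D S j *ᵥ fun k => -(L j j)⁻¹ * L k.1 j := by
    ext i
    have h1 := mul_apply_eq_add_sum_laterNbr hL hD S i.1 j
    rw [hS, inv_mul_transpose_mul hdet, transpose_apply,
      inv_apply_eq_zero_of_lower hL.1 hdet i.2.1, ← hS] at h1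
    have h2 : (blockGt D S j *ᵥ fun k => -(L j j)⁻¹ * L k.1 j) i =
        -(L j j)⁻¹ * ∑ k : LaterNbr D j, S i k.1 * L k.1 j := by
      simp only [mulVec, dotProduct, blockGt, of_apply, Finset.mul_sum]
      exact Finset.sum_congr rfl fun k _ => by ring
    have h3 := (hL.2 j).ne'
    rw [h2, colGt]
    field_simp
    linarith
  have h4 : regCoef D S j = (blockGt D S j)⁻¹ *ᵥ colGt D S j := rfl
  rw [h4, hcol, mulVec_mulVec, nonsing_inv_mul _ (blockGt_det_ne_zero hpos j).isUnit, one_mulVec]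

/-- The diagonal entry of $SL=L^{-T}$ gives $S_{jj}L_{jj}+\sum_{k\in N_j}S_{jk}L_{kj}=L_{jj}^{-1}$;
divide by $L_{jj}$. -/
theorem residVar_eq (hL : L ∈ lowerPos p) (hD : ∀ i j, j < i → ¬ D.Adj i j → L i j = 0)
    (j : Fin p) : residVar D (L * Lᵀ)⁻¹ j = ((L j j)⁻¹) ^ 2 := by
  classical
  have hdet := isUnit_det_of_mem_lowerPos hL
  have hsymm : ∀ a b, (L * Lᵀ)⁻¹ a b = (L * Lᵀ)⁻¹ b a := fun a b => by
    simpa using ((posDef_inv_of_mem_lowerPos hL).isHermitian.apply a b).symm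
  have h1 := mul_apply_eq_add_sum_laterNbr hL hD (L * Lᵀ)⁻¹ j j
  rw [inv_mul_transpose_mul hdet, transpose_apply] at h1
  have h2 := inv_apply_self_mul_of_lower hL.1 hdet j
  have h3 := (hL.2 j).ne'
  have h4 : L⁻¹ j j = (L j j)⁻¹ := eq_inv_of_mul_eq_one_left h2
  rw [h4] at h1
  simp only [residVar, dotProduct, regCoef_eq hL hD, colGt]
  rw [pow_two]
  nth_rw 3 [h1]
  rw [mul_add, Finset.mul_sum, sub_eq_add_neg, ← Finset.sum_neg_distrib]
  congr 1
  · field_simp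
  · exact Finset.sum_congr rfl fun k _ => by rw [hsymm k.1 j]; ring

/-- Step I recovers the Cholesky factor from the exact covariance matrix. -/
theorem interChol_inv_mul_transpose (hL : L ∈ lowerPos p)
    (hD : ∀ i j, j < i → ¬ D.Adj i j → L i j = 0) : interChol D (L * Lᵀ)⁻¹ = L := by
  ext i j
  have hr : √(residVar D (L * Lᵀ)⁻¹ j) = (L j j)⁻¹ := by
    rw [residVar_eq hL hD, Real.sqrt_sq (inv_nonneg.2 (hL.2 j).le)]
  have h3 := (hL.2 j).ne'
  simp only [interChol, of_apply]
  split_ifs with h h'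
  · subst h
    rw [hr, one_div, inv_inv]
  · rw [hr, regCoef_eq hL hD]
    field_simp
  · rcases Ne.lt_or_gt h with h1 | h1
    · exact (hL.1 i j h1).symm
    · exact (hD i j h1 fun hadj => h' ⟨h1, hadj⟩).symm

/-- The updates of Step II do not change a Cholesky factor of a matrix in `ℙ_H`. -/
theorem updateEntry_eq_self (hL : L ∈ cholSpace H) {i j : Fin p} (hij : j < i) :
    updateEntry H i j L = L := by
  unfold updateEntry
  split_ifs with hadj
  · rfl
  ext a b
  rw [of_apply]
  split_ifs with hab
  · obtain ⟨rfl, rfl⟩ := hab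
    -- The entry of $LL^T$ at a non-edge is zero, and triangularity ends its sum at $k=b$; solving
    -- for $L_{ab}$ gives the update formula.
    have h0 := hL.2.2 a b hij.ne' hadj
    have hsum : ∑ k, L a k * L b k =
        (∑ k ∈ Finset.univ.filter (fun k => k < b), L a k * L b k) + L a b * L b b := by
      rw [← Finset.sum_filter_add_sum_filter_not Finset.univ (fun k => k < b)]
      congr 1
      refine Finset.sum_eq_single b (fun k hk hkb => ?_) (by simp)
      have hk' : b < k := lt_of_le_of_ne (by simpa using hk) (Ne.symm hkb)
      rw [hL.1.1 b k hk', mul_zero]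
    rw [mul_apply] at h0
    simp only [transpose_apply] at h0
    rw [hsum] at h0
    rw [div_eq_iff (hL.1.2 b).ne']
    linarith
  · rfl

end FixedPoint

/-! ### Induction over the updates of Step II. -/

section StepTwoInduction

variable {p : ℕ} {H : SimpleGraph (Fin p)} {E : Type*}

/-- The invariant concerns whole maps `E → β`, not single values, so that it can be measurability or
differentiability. -/
theorem foldl_induction {α β : Type*} {Q : (E → β) → Prop} {f : α → β → β} (l : List α)
    (hf : ∀ a ∈ l, ∀ M, Q M → Q fun x => f a (M x)) (M : E → β) (hM : Q M) :
    Q fun x => l.foldl (fun b a => f a b) (M x) := by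
  induction l generalizing M with
  | nil => exact hM
  | cons a l ih =>
    exact ih (fun b hb => hf b (List.mem_cons_of_mem a hb)) _ (hf a List.mem_cons_self M hM)

/-- A property of matrix valued functions that is preserved by every update of Step II is
preserved by Step II. -/
theorem stepTwo_induction {Q : (E → Matrix (Fin p) (Fin p) ℝ) → Prop}
    (hstep : ∀ i j, j < i → ∀ M, Q M → Q fun x => updateEntry H i j (M x))
    (M : E → Matrix (Fin p) (Fin p) ℝ) (hM : Q M) : Q fun x => stepTwo H (M x) :=
  foldl_induction (Q := Q) (f := fun i L => ((List.finRange p).filter fun j => decide (j < i)).foldl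
    (fun L j => updateEntry H i j L) L) _
    (fun i _ M hM => foldl_induction (Q := Q) (f := fun j L => updateEntry H i j L) _
      (fun j hj M hM => hstep i j (by simpa using hj) M hM) M hM) M hM

end StepTwoInduction

/-! ### Regularity of determinants and inverses. -/

section Entrywise

variable {n : Type*} [Fintype n] [DecidableEq n]

theorem measurable_det_of_entries {E : Type*} [MeasurableSpace E] {M : E → Matrix n n ℝ}
    (hM : ∀ i j, Measurable fun x => M x i j) : Measurable fun x => (M x).det := by
  simp only [det_apply]
  fun_prop

theorem measurable_inv_of_entries {E : Type*} [MeasurableSpace E] {M : E → Matrix n n ℝ}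
    (hM : ∀ i j, Measurable fun x => M x i j) (i j : n) : Measurable fun x => (M x)⁻¹ i j := by
  have hadj : Measurable fun x => (M x).adjugate i j := by
    simp only [adjugate_apply]
    refine measurable_det_of_entries fun a b => ?_
    simp only [updateRow_apply]
    split_ifs
    · exact measurable_const
    · exact hM a b
  simp only [inv_def, Ring.inverse_eq_inv', Matrix.smul_apply, smul_eq_mul]
  exact (measurable_det_of_entries hM).inv.mul hadj

variable {E : Type*} [NormedAddCommGroup E] [NormedSpace ℝ E] {M : E → Matrix n n ℝ} {x₀ : E}

theorem differentiableAt_det_of_entries (hM : ∀ i j, DifferentiableAt ℝ (fun x => M x i j) x₀) :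
    DifferentiableAt ℝ (fun x => (M x).det) x₀ := by
  simp only [det_apply]
  fun_prop

theorem differentiableAt_inv_of_entries (hM : ∀ i j, DifferentiableAt ℝ (fun x => M x i j) x₀)
    (hdet : (M x₀).det ≠ 0) (i j : n) : DifferentiableAt ℝ (fun x => (M x)⁻¹ i j) x₀ := by
  have hadj : DifferentiableAt ℝ (fun x => (M x).adjugate i j) x₀ := by
    simp only [adjugate_apply]
    refine differentiableAt_det_of_entries fun a b => ?_
    simp only [updateRow_apply]
    split_ifs
    · exact differentiableAt_const _
    · exact hM a b
  simp only [inv_def, Ring.inverse_eq_inv', Matrix.smul_apply, smul_eq_mul]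
  exact ((differentiableAt_det_of_entries hM).inv hdet).mul hadj

end Entrywise

/-! ### Measurability of the estimator. -/

section Measurability

variable {p : ℕ} {H D : SimpleGraph (Fin p)} {E : Type*} [MeasurableSpace E]
  {S : E → Matrix (Fin p) (Fin p) ℝ}

theorem measurable_regCoef (hS : ∀ i j, Measurable fun x => S x i j) (j : Fin p)
    (k : LaterNbr D j) : Measurable fun x => regCoef D (S x) j k := by
  classical
  simp only [regCoef, mulVec, dotProduct]
  refine Finset.measurable_sum _ fun (l : LaterNbr D j) _ => Measurable.mul ?_ (hS l.1 j)
  exact measurable_inv_of_entries (M := fun x => blockGt D (S x) j) (fun a b => hS a.1 b.1) k l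

theorem measurable_residVar (hS : ∀ i j, Measurable fun x => S x i j) (j : Fin p) :
    Measurable fun x => residVar D (S x) j :=
  (hS j j).sub (Finset.measurable_sum _ fun k _ => (hS k.1 j).mul (measurable_regCoef hS j k))

theorem measurable_interChol (hS : ∀ i j, Measurable fun x => S x i j) (i j : Fin p) :
    Measurable fun x => interChol D (S x) i j := by
  simp only [interChol, of_apply]
  split_ifs with h h'
  · exact measurable_const.div (measurable_residVar hS j).sqrt
  · exact (measurable_regCoef hS j _).neg.div (measurable_residVar hS j).sqrt
  · exact measurable_const

theorem measurable_updateEntry (i j : Fin p) (M : E → Matrix (Fin p) (Fin p) ℝ)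
    (hM : ∀ i j, Measurable fun x => M x i j) (a b : Fin p) :
    Measurable fun x => updateEntry H i j (M x) a b := by
  unfold updateEntry
  split_ifs
  · exact hM a b
  simp only [of_apply]
  split_ifs
  · exact (Finset.measurable_sum _ fun k _ => (hM i k).mul (hM j k)).neg.div (hM j j)
  · exact hM a b

/-- Every operation, default values included, is measurable everywhere, so singular `S` needs no
separate treatment. -/
theorem measurable_ccaEstimator (hS : ∀ i j, Measurable fun x => S x i j) (i j : Fin p) :
    Measurable fun x => ccaEstimator H (S x) i j := by
  have hL : ∀ a b, Measurable fun x => ccaChol H (S x) a b :=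
    stepTwo_induction (H := H) (Q := fun M => ∀ a b, Measurable fun x => M x a b)
      (fun i j _ M hM => measurable_updateEntry i j M hM) _ (measurable_interChol hS)
  simp only [ccaEstimator, mul_apply, transpose_apply]
  exact Finset.measurable_sum _ fun k _ => (hL i k).mul (hL j k)

end Measurability

/-! ### Differentiability at the true covariance matrix. -/

section Differentiability

variable {p : ℕ} {H D : SimpleGraph (Fin p)} {E : Type*} [NormedAddCommGroup E] [NormedSpace ℝ E]
  {S : E → Matrix (Fin p) (Fin p) ℝ} {x₀ : E} {L : Matrix (Fin p) (Fin p) ℝ}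

theorem differentiableAt_regCoef (hS : ∀ i j, DifferentiableAt ℝ (fun x => S x i j) x₀)
    (hpos : (S x₀).PosDef) (j : Fin p) (k : LaterNbr D j) :
    DifferentiableAt ℝ (fun x => regCoef D (S x) j k) x₀ := by
  classical
  simp only [regCoef, mulVec, dotProduct]
  refine DifferentiableAt.fun_sum fun (l : LaterNbr D j) _ => DifferentiableAt.mul ?_ (hS l.1 j)
  exact differentiableAt_inv_of_entries (M := fun x => blockGt D (S x) j)
    (fun a b => hS a.1 b.1) (by convert! blockGt_det_ne_zero hpos j) k l

theorem differentiableAt_residVar (hS : ∀ i j, DifferentiableAt ℝ (fun x => S x i j) x₀)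
    (hpos : (S x₀).PosDef) (j : Fin p) : DifferentiableAt ℝ (fun x => residVar D (S x) j) x₀ :=
  (hS j j).sub (DifferentiableAt.fun_sum fun k _ =>
    (hS k.1 j).mul (differentiableAt_regCoef hS hpos j k))

theorem differentiableAt_interChol (hS : ∀ i j, DifferentiableAt ℝ (fun x => S x i j) x₀)
    (hL : L ∈ lowerPos p) (hD : ∀ i j, j < i → ¬ D.Adj i j → L i j = 0)
    (hx₀ : S x₀ = (L * Lᵀ)⁻¹) (i j : Fin p) :
    DifferentiableAt ℝ (fun x => interChol D (S x) i j) x₀ := by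
  have hpos : (S x₀).PosDef := hx₀ ▸ posDef_inv_of_mem_lowerPos hL
  have hr : 0 < residVar D (S x₀) j := by
    rw [hx₀, residVar_eq hL hD]
    exact pow_pos (inv_pos.2 (hL.2 j)) 2
  have hs : DifferentiableAt ℝ (fun x => √(residVar D (S x) j)) x₀ :=
    (differentiableAt_residVar hS hpos j).sqrt hr.ne'
  have hs0 : √(residVar D (S x₀) j) ≠ 0 := (Real.sqrt_pos.2 hr).ne'
  simp only [interChol, of_apply, div_eq_mul_inv]
  split_ifs with h h'
  · exact (differentiableAt_const _).mul (hs.inv hs0)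
  · exact (differentiableAt_regCoef hS hpos j _).neg.mul (hs.inv hs0)
  · exact differentiableAt_const _

theorem differentiableAt_updateEntry (i j : Fin p) (M : E → Matrix (Fin p) (Fin p) ℝ)
    (hM : ∀ i j, DifferentiableAt ℝ (fun x => M x i j) x₀) (h0 : M x₀ j j ≠ 0) (a b : Fin p) :
    DifferentiableAt ℝ (fun x => updateEntry H i j (M x) a b) x₀ := by
  unfold updateEntry
  split_ifs
  · exact hM a b
  simp only [of_apply, div_eq_mul_inv]
  split_ifs
  · exact (DifferentiableAt.fun_sum fun k _ => (hM i k).mul (hM j k)).neg.mul ((hM j j).inv h0)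
  · exact hM a b

/-- The CCA estimator is Fisher consistent, and differentiable at the true covariance matrix. -/
theorem ccaEstimator_eq_and_differentiableAt {A : Matrix (Fin p) (Fin p) ℝ}
    (hA : A ∈ posDefSpace H) (hS : ∀ i j, DifferentiableAt ℝ (fun x => S x i j) x₀)
    (hx₀ : S x₀ = A⁻¹) :
    ccaEstimator H (S x₀) = A ∧
      ∀ i j, DifferentiableAt ℝ (fun x => ccaEstimator H (S x) i j) x₀ := by
  obtain ⟨L, hL, rfl⟩ := exists_cholesky hA.1
  have hLH : L ∈ cholSpace H := ⟨hL, hA⟩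
  have hD := (isLeast_filledGraph H).1.chol_zero L hLH
  -- The value at `x₀` belongs to the invariant: it keeps each pivot equal to $L_{jj}>0$, as
  -- differentiating the division requires.
  have key : ccaChol H (S x₀) = L ∧
      ∀ a b, DifferentiableAt ℝ (fun x => ccaChol H (S x) a b) x₀ :=
    stepTwo_induction (H := H)
      (Q := fun M => M x₀ = L ∧ ∀ a b, DifferentiableAt ℝ (fun x => M x a b) x₀)
      (fun i j hij M hM => ⟨by simpa only [hM.1] using updateEntry_eq_self hLH hij,
        differentiableAt_updateEntry i j M hM.2 (by rw [hM.1]; exact (hL.2 j).ne')⟩) _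
      ⟨by rw [hx₀]; exact interChol_inv_mul_transpose hL hD,
        differentiableAt_interChol hS hL hD hx₀⟩
  refine ⟨by rw [ccaEstimator, key.1], fun i j => ?_⟩
  simp only [ccaEstimator, mul_apply, transpose_apply]
  exact DifferentiableAt.fun_sum fun k _ => (key.2 i k).mul (key.2 j k)

end Differentiability

/-! ### Asymptotic normality of the sample covariance matrix. -/

section SampleCovariance

theorem inv_mul_sum_sub_mean_mul_sub_mean (n : ℕ) (a b : ℕ → ℝ) (m m' : ℝ) :
    (n : ℝ)⁻¹ * ∑ t ∈ Finset.range n, (a t - (n : ℝ)⁻¹ * ∑ s ∈ Finset.range n, a s) *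
        (b t - (n : ℝ)⁻¹ * ∑ s ∈ Finset.range n, b s) =
      (n : ℝ)⁻¹ * ∑ t ∈ Finset.range n, (a t - m) * (b t - m') -
        ((n : ℝ)⁻¹ * ∑ t ∈ Finset.range n, (a t - m)) *
          ((n : ℝ)⁻¹ * ∑ t ∈ Finset.range n, (b t - m')) := by
  rcases Nat.eq_zero_or_pos n with rfl | hn
  · simp
  have hn' : (n : ℝ) ≠ 0 := by exact_mod_cast hn.ne'
  simp only [sub_mul, mul_sub, Finset.sum_sub_distrib, ← Finset.mul_sum, ← Finset.sum_mul,
    Finset.sum_const, Finset.card_range, nsmul_eq_mul]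
  field_simp
  ring

theorem tendsto_sqrt_mul_inv_sub_one :
    Tendsto (fun n : ℕ => √(n : ℝ) * ((n : ℝ) - 1)⁻¹) atTop (𝓝 0) := by
  -- For $n\ge2$, $n-1\ge n/2$ gives the bound $2/\sqrt n$.
  have h1 : Tendsto (fun n : ℕ => 2 * (√(n : ℝ))⁻¹) atTop (𝓝 0) := by
    simpa using (tendsto_inv_atTop_zero.comp
      (Real.tendsto_sqrt_atTop.comp tendsto_natCast_atTop_atTop)).const_mul (2 : ℝ)
  refine squeeze_zero' ?_ ?_ h1
  · filter_upwards [eventually_ge_atTop 2] with n hn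
    have : (2 : ℝ) ≤ n := by exact_mod_cast hn
    exact mul_nonneg (Real.sqrt_nonneg _) (inv_nonneg.2 (by linarith))
  · filter_upwards [eventually_ge_atTop 2] with n hn
    have h2 : (2 : ℝ) ≤ n := by exact_mod_cast hn
    have h3 : 0 < √(n : ℝ) := Real.sqrt_pos.2 (by linarith)
    have h4 : √(n : ℝ) * √(n : ℝ) = n := Real.mul_self_sqrt (by linarith)
    rw [← div_eq_mul_inv, ← div_eq_mul_inv, div_le_div_iff₀ (by linarith) h3, h4]
    linarith

variable {Ω : Type*} [MeasurableSpace Ω] {P : Measure Ω} {p : ℕ}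
  {F : Measure (Fin p → ℝ)}

theorem memLp_four_of_integrable
    (hmom : ∀ a : Fin p → ℕ, ∑ i, a i = 4 → Integrable (fun x => ∏ i, |x i| ^ a i) F)
    (i : Fin p) : MemLp (fun x => x i) 4 F := by
  have h := hmom (Pi.single i 4) (by simp)
  rw [← integrable_norm_rpow_iff (measurable_pi_apply i).aestronglyMeasurable
    (by norm_num) (by norm_num)]
  convert! h using 2 with x
  rw [Finset.prod_eq_single i]
  · rw [Pi.single_eq_same, Real.norm_eq_abs, ENNReal.toReal_ofNat]
    exact Real.rpow_natCast _ 4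
  · intro j _ hj
    simp [hj]
  · simp

/-- The centred first and second order monomials of a vector. -/
def centredMoments (m x : Fin p → ℝ) : Fin p ⊕ Fin p × Fin p → ℝ :=
  Sum.elim (fun i => x i - m i) fun q => (x q.1 - m q.1) * (x q.2 - m q.2)

theorem measurable_centredMoments (m : Fin p → ℝ) : Measurable (centredMoments m) := by
  refine measurable_pi_iff.2 fun k => ?_
  rcases k with i | q
  · exact (measurable_pi_apply i).sub_const _
  · exact ((measurable_pi_apply q.1).sub_const _).mul ((measurable_pi_apply q.2).sub_const _)

theorem memLp_centredMoments [IsProbabilityMeasure F] (h : ∀ i, MemLp (fun x => x i) 4 F)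
    (m : Fin p → ℝ) (k : Fin p ⊕ Fin p × Fin p) :
    MemLp (fun x => centredMoments m x k) 2 F := by
  have h4 : ∀ i, MemLp (fun x : Fin p → ℝ => x i - m i) 4 F := fun i => (h i).sub (memLp_const _)
  -- Hölder: a product of two $L^4$ functions is in $L^2$.
  have : ENNReal.HolderTriple 4 4 2 := ⟨by
    rw [← ENNReal.toReal_eq_toReal_iff' (by simp) (by simp), ENNReal.toReal_add (by simp) (by simp)]
    simp
    norm_num⟩
  rcases k with i | q
  · exact (h4 i).mono_exponent (by norm_num)
  · exact (h4 q.2).mul' (h4 q.1)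

theorem aemeasurable_mean_centredMoments {Y : ℕ → Ω → Fin p → ℝ} (hlaw : ∀ t, HasLaw (Y t) F P)
    (m : Fin p → ℝ) (n : ℕ) : AEMeasurable
      (fun ω => (n : ℝ)⁻¹ • ∑ t ∈ Finset.range n, centredMoments m (Y t ω)) P := by
  refine AEMeasurable.const_smul (Finset.aemeasurable_fun_sum _ fun t _ => ?_) (n : ℝ)⁻¹
  exact (measurable_centredMoments m).comp_aemeasurable (hlaw t).aemeasurable

theorem aemeasurable_sampleCov {Y : ℕ → Ω → Fin p → ℝ} (hY : ∀ t, AEMeasurable (Y t) P)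
    (c : SampleCovKind) (n : ℕ) :
    AEMeasurable (fun ω i j => sampleCov c n (fun t => Y t ω) i j : Ω → Fin p → Fin p → ℝ) P := by
  have hY' : ∀ t i, AEMeasurable (fun ω => Y t ω i) P := fun t i =>
    (measurable_pi_apply i).comp_aemeasurable (hY t)
  refine aemeasurable_pi_iff.2 fun i => aemeasurable_pi_iff.2 fun j => ?_
  cases c <;> simp only [sampleCov, sampleMean, of_apply] <;> fun_prop

variable [IsProbabilityMeasure P]

theorem asympNormal_mean_centredMoments {Y : ℕ → Ω → Fin p → ℝ}
    (hindep : iIndepFun Y P) (hlaw : ∀ t, HasLaw (Y t) F P)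
    (h : ∀ i, MemLp (fun x => x i) 4 F) (m : Fin p → ℝ) (hm : ∀ i, ∫ x, x i ∂F = m i) :
    AsympNormal P (fun n ω => (n : ℝ)⁻¹ • ∑ t ∈ Finset.range n, centredMoments m (Y t ω))
      (Sum.elim (fun _ => 0) fun q => covarianceMatrix F q.1 q.2) := by
  have hF : IsProbabilityMeasure F := (hlaw 0).isProbabilityMeasure_iff.1 inferInstance
  have hw := measurable_centredMoments m
  have hL : ∀ k, MemLp (fun ω => centredMoments m (Y 0 ω) k) 2 P := fun k => by
    have := memLp_centredMoments h m k
    rw [← (hlaw 0).map_eq] at this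
    exact this.comp_of_map (hlaw 0).aemeasurable
  convert! asympNormal_mean (X := fun t ω => centredMoments m (Y t ω))
    (hindep.comp (fun _ => centredMoments m) fun _ => hw)
    (fun t => ((hlaw t).identDistrib (hlaw 0)).comp hw) hL using 1
  ext k
  have hint : ∫ ω, centredMoments m (Y 0 ω) k ∂P = ∫ x, centredMoments m x k ∂F :=
    (hlaw 0).integral_comp (f := fun x => centredMoments m x k)
      (measurable_pi_iff.1 hw k).aestronglyMeasurable
  rw [hint]
  rcases k with i | q
  · have hi : Integrable (fun x : Fin p → ℝ => x i) F := (h i).integrable (by norm_num)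
    simp only [centredMoments, Sum.elim_inl]
    rw [integral_sub hi (integrable_const _), hm]
    simp
  · simp only [centredMoments, Sum.elim_inr, covarianceMatrix, of_apply, covariance, hm]

theorem asympNormal_sampleCov_aboutZero {Y : ℕ → Ω → Fin p → ℝ}
    (hindep : iIndepFun Y P) (hlaw : ∀ t, HasLaw (Y t) F P)
    (h : ∀ i, MemLp (fun x => x i) 4 F) (hm : ∀ i, ∫ x, x i ∂F = 0) :
    AsympNormal P (fun n ω i j => sampleCov .aboutZero n (fun t => Y t ω) i j)
      (fun i j => covarianceMatrix F i j) := by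
  have hT := asympNormal_mean_centredMoments hindep hlaw h 0 hm
  let g : (Fin p ⊕ Fin p × Fin p → ℝ) →L[ℝ] Fin p → Fin p → ℝ :=
    ContinuousLinearMap.pi fun i => ContinuousLinearMap.pi fun j =>
      ContinuousLinearMap.proj (Sum.inr (i, j))
  have := hT.comp_hasFDerivAt g.hasFDerivAt fun n =>
    g.continuous.measurable.comp_aemeasurable (aemeasurable_mean_centredMoments hlaw 0 n)
  convert! this using 1
  ext n ω i j
  simp [g, sampleCov, centredMoments]

theorem asympNormal_sampleCov_aboutMean {Y : ℕ → Ω → Fin p → ℝ}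
    (hindep : iIndepFun Y P) (hlaw : ∀ t, HasLaw (Y t) F P)
    (h : ∀ i, MemLp (fun x => x i) 4 F) :
    AsympNormal P (fun n ω i j => sampleCov .aboutMean n (fun t => Y t ω) i j)
      (fun i j => covarianceMatrix F i j) := by
  have hT := asympNormal_mean_centredMoments hindep hlaw h (fun i => ∫ x, x i ∂F) fun _ => rfl
  -- Centring at the true mean makes the first-order coordinates of the limit point zero, so the
  -- product correction vanishes there.
  let g : (Fin p ⊕ Fin p × Fin p → ℝ) → Fin p → Fin p → ℝ := fun x i j =>
    x (Sum.inr (i, j)) - x (Sum.inl i) * x (Sum.inl j)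
  have hg : Differentiable ℝ g := by fun_prop
  have := hT.comp_hasFDerivAt (hg _).hasFDerivAt fun n =>
    hg.continuous.measurable.comp_aemeasurable (aemeasurable_mean_centredMoments hlaw _ n)
  convert! this using 1
  · ext n ω i j
    simp only [g, sampleCov, sampleMean, of_apply]
    rw [inv_mul_sum_sub_mean_mul_sub_mean n (fun t => Y t ω i) (fun t => Y t ω j)
      (∫ x, x i ∂F) (∫ x, x j ∂F)]
    simp [centredMoments]
  · ext i j
    simp [g]

theorem asympNormal_sampleCov {Y : ℕ → Ω → Fin p → ℝ}
    (hindep : iIndepFun Y P) (hlaw : ∀ t, HasLaw (Y t) F P)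
    (h : ∀ i, MemLp (fun x => x i) 4 F) (c : SampleCovKind)
    (hc : c = .aboutZero → ∀ i, ∫ x, x i ∂F = 0) :
    AsympNormal P (fun n ω i j => sampleCov c n (fun t => Y t ω) i j)
      (fun i j => covarianceMatrix F i j) := by
  match c with
  | .aboutZero => exact asympNormal_sampleCov_aboutZero hindep hlaw h (hc rfl)
  | .aboutMean => exact asympNormal_sampleCov_aboutMean hindep hlaw h
  | .aboutMeanUnbiased =>
    have h1 : ∀ᶠ n : ℕ in atTop, 1 + ((n : ℝ) - 1)⁻¹ = n * ((n : ℝ) - 1)⁻¹ := by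
      filter_upwards [eventually_ge_atTop 2] with n hn
      have h2 : (2 : ℝ) ≤ n := by exact_mod_cast hn
      have h3 : (n : ℝ) - 1 ≠ 0 := by linarith
      field_simp
      ring
    have h2 : Tendsto (fun n : ℕ => ((n : ℝ) - 1)⁻¹) atTop (𝓝 0) :=
      tendsto_inv_atTop_zero.comp (tendsto_atTop_add_const_right _ _ tendsto_natCast_atTop_atTop)
    have := (asympNormal_sampleCov_aboutMean hindep hlaw h).smul
      (c := fun n => n * ((n : ℝ) - 1)⁻¹)
      (by simpa using (h2.const_add 1).congr' h1)
      (tendsto_sqrt_mul_inv_sub_one.congr' (by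
        filter_upwards [h1] with n hn
        rw [← hn, add_sub_cancel_left]))
    convert! this using 1
    ext n ω i j
    simp only [sampleCov, of_apply, Pi.smul_apply, smul_eq_mul]
    -- The identity must hold for every `n`: at `0` the sums are empty, and at `1` both sides carry
    -- the factor `0⁻¹ = 0`.
    rcases Nat.eq_zero_or_pos n with rfl | hn
    · simp
    have hn' : (n : ℝ) ≠ 0 := by exact_mod_cast hn.ne'
    field_simp

end SampleCovariance

end CCA

/-! ### The main theorem. -/

theorem theoremS1 {V : Type*} {p : ℕ} (G : SimpleGraph V) (σ : V ≃ Fin p)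
    {Ω : Type*} [MeasurableSpace Ω] (P : Measure Ω) [IsProbabilityMeasure P]
    (F : Measure (Fin p → ℝ)) (Y : ℕ → Ω → Fin p → ℝ)
    (hindep : iIndepFun Y P) (hlaw : ∀ t, HasLaw (Y t) F P)
    (Ωbar : Matrix (Fin p) (Fin p) ℝ)
    (hΩ : Ωbar ∈ CCA.posDefSpace (CCA.orderedGraph G σ))
    (hcov : CCA.covarianceMatrix F = Ωbar⁻¹)
    (hmom : ∀ a : Fin p → ℕ, ∑ i, a i = 4 → Integrable (fun x => ∏ i, |x i| ^ a i) F)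
    (c : CCA.SampleCovKind) (hc : c = .aboutZero → ∀ i, ∫ x, x i ∂F = 0)
    (Ωhat : ℕ → Ω → Matrix (Fin p) (Fin p) ℝ)
    (hΩhat : ∀ n ω, Ωhat n ω =
      CCA.ccaEstimator (CCA.orderedGraph G σ) (CCA.sampleCov c n (fun t => Y t ω))) :
    (∀ ε : ℝ, 0 < ε → ∃ M : ℝ, ∀ n : ℕ,
      P.real {ω | ∃ i j, M < √(n : ℝ) * |Ωhat n ω i j - Ωbar i j|} ≤ ε) ∧
    ∃ (ν : Measure (Fin p → Fin p → ℝ)) (_ : IsGaussian ν),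
      (∀ i j, ∫ A, A i j ∂ν = 0) ∧
      TendstoInDistribution (fun (n : ℕ) ω i j => √(n : ℝ) * (Ωhat n ω i j - Ωbar i j))
        atTop id (fun _ => P) ν := by
  have hS := CCA.asympNormal_sampleCov hindep hlaw (CCA.memLp_four_of_integrable hmom) c hc
  let f : (Fin p → Fin p → ℝ) → Fin p → Fin p → ℝ := fun y i j =>
    CCA.ccaEstimator (CCA.orderedGraph G σ) (Matrix.of y) i j
  obtain ⟨hval, hdiff⟩ := CCA.ccaEstimator_eq_and_differentiableAt (S := Matrix.of)
    (x₀ := fun i j => CCA.covarianceMatrix F i j) hΩ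
    (fun i j => by simp only [Matrix.of_apply]; fun_prop) hcov
  have hf : DifferentiableAt ℝ f fun i j => CCA.covarianceMatrix F i j :=
    differentiableAt_pi.2 fun i => differentiableAt_pi.2 fun j => hdiff i j
  have hfm : Measurable f := measurable_pi_iff.2 fun i => measurable_pi_iff.2 fun j =>
    CCA.measurable_ccaEstimator (S := Matrix.of)
      (fun a b => by simp only [Matrix.of_apply]; fun_prop) i j
  have hSm : ∀ n, AEMeasurable
      (fun ω i j => CCA.sampleCov c n (fun t => Y t ω) i j : Ω → Fin p → Fin p → ℝ) P := fun n =>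
    CCA.aemeasurable_sampleCov (fun t => (hlaw t).aemeasurable) c n
  have hΩn := hS.comp_hasFDerivAt hf.hasFDerivAt fun n => hfm.comp_aemeasurable (hSm n)
  have hfθ : f (fun i j => CCA.covarianceMatrix F i j) = fun i j => Ωbar i j := by
    ext i j
    exact congrFun (congrFun hval i) j
  have hfn : ∀ n ω, f (fun i j => CCA.sampleCov c n (fun t => Y t ω) i j) =
      fun i j => Ωhat n ω i j := fun n ω => by
    ext i j
    rw [hΩhat]
    rfl
  rw [hfθ] at hΩn
  simp only [hfn] at hΩn
  refine ⟨fun ε hε => ?_, ?_⟩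
  · obtain ⟨M, hM⟩ := hΩn.exists_bound hε
    refine ⟨M, fun n => (measureReal_mono ?_).trans (hM n)⟩
    rintro ω ⟨i, j, hij⟩
    refine hij.trans_le (mul_le_mul_of_nonneg_left ?_ (Real.sqrt_nonneg _))
    exact (norm_le_pi_norm ((fun i j => Ωhat n ω i j - Ωbar i j : Fin p → Fin p → ℝ) i) j).trans
      (norm_le_pi_norm (fun i j => Ωhat n ω i j - Ωbar i j : Fin p → Fin p → ℝ) i)
  · obtain ⟨ν, hν, h0, hlim⟩ := hΩn
    -- Coordinate functionals commute with the integral, so the vector-valued mean zero passes to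
    -- each entry.
    refine ⟨ν, hν, fun i j => ?_, hlim⟩
    have := (ContinuousLinearMap.proj (R := ℝ) (φ := fun _ : Fin p => ℝ) j ∘L
      ContinuousLinearMap.proj (R := ℝ) (φ := fun _ : Fin p => Fin p → ℝ) i).integral_comp_comm
      (μ := ν) (φ := fun x => x) (by exact IsGaussian.integrable_id)
    rw [h0] at this
    simpa using this
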